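/- Let $n\ge 2$ be an integer and let $\alpha,\beta>0$. For $\gamma>0$ let $d\mu_\gamma(y)=(\pi\gamma)^{-n/2}e^{-|y|^2/\gamma}\,dy$ be the Gaussian probability measure on $\mathbb{R}^n$. For $m\ge 0$, $x\in\mathbb{R}^n$ and a unit vector $\xi$, let $\mathcal{Y}_m(x,\xi)$ be the zonal harmonic of degree $m$ with pole $\xi$, that is, $\mathcal{Y}_0=1$ and, for $m>0$, $$\mathcal{Y}_m(x,\xi)=(n+2m-2)\sum_{k=0}^{\lfloor m/2\rfloor}(-1)^k\,\frac{n(n+2)\cdots(n+2m-2k-4)}{2^k\,k!\,(m-2k)!}\,\langle x,\xi\rangle^{m-2k}|x|^{2k}$$ (the product has $m-k-1$ factors, and an empty product is $1$). For $y\in\mathbb{R}^n\setminus\{0\}$ put $Y_m(x,y)=|y|^m\,\mathcal{Y}_m(x,y/|y|)$, and put $Y_0(x,0)=1$ and $Y_m(x,0)=0$ for $m>0$. The harmonic Fock kernel is $$H_\alpha(x,y)=\sum_{k=0}^\infty\frac{Y_k(x,y)}{\alpha^k\,(n/2)_k},\qquad (a)_k=a(a+1)\cdots(a+k-1),$$ and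 $P_\alpha$ is the integral operator $$P_\alpha f(x)=\int_{\mathbb{R}^n}H_\alpha(x,y)f(y)\,d\mu_\alpha(y)$$ (on $L^2(\mathbb{R}^n,d\mu_\alpha)$ it is the orthogonal projection onto the subspace of harmonic functions), defined for those real- or complex-valued $f$ for which the integral converges absolutely for almost every $x$. For $0<p<\infty$, say that $P_\alpha$ is bounded on $L^p(\mathbb{R}^n,d\mu_\beta)$ if there is a constant $C$ such that $P_\alpha f\in L^p(\mathbb{R}^n,d\mu_\beta)$ and $\|P_\alpha f\|_{L^p(d\mu_\beta)}\le C\|f\|_{L^p(d\mu_\beta)}$ for every $f\in L^p(\mathbb{R}^n,d\mu_\beta)$ for which $P_\alpha f$ is defined. Then: 1. If $1\le p<\infty$ and $P_\alpha$ is bounded on $L^p(\mathbb{R}^n,d\mu_\beta)$, then $p\beta=2\alpha$. 2. If $0<p<1$, then $P_\alpha$ is not bounded on $L^p(\mathbb{R}^n,d\mu_\beta)$. -/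

import Mathlib

open MeasureTheory
open scoped ENNReal NNReal

noncomputable section

namespace HarmonicFock

/-- The probability measure `(π α)^(-n/2) exp (-|y|² / α) dy` on `ℝⁿ`. -/
def gaussian (n : ℕ) (α : ℝ) : Measure (EuclideanSpace ℝ (Fin n)) :=
  volume.withDensity fun y =>
    ENNReal.ofReal ((Real.pi * α) ^ (-(n : ℝ) / 2) * Real.exp (-‖y‖ ^ 2 / α))

/-- The zonal harmonic of degree `m` with pole `ξ` (a unit vector), as a homogeneous harmonic
polynomial in `x ∈ ℝⁿ`: it is `1` for `m = 0`, and for `m > 0` it is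
`(n+2m-2) ∑_{k ≤ m/2} (-1)^k n(n+2)⋯(n+2m-2k-4) / (2^k k! (m-2k)!) ⟨x,ξ⟩^(m-2k) |x|^(2k)`.
The product has `m - k - 1 ≥ 0` factors, so no natural subtraction below truncates when
`m > 0`. -/
def zonal {n : ℕ} (m : ℕ) (x ξ : EuclideanSpace ℝ (Fin n)) : ℝ :=
  if m = 0 then 1
  else ((n : ℝ) + 2 * m - 2) * ∑ k ∈ Finset.range (m / 2 + 1),
    (-1) ^ k * (∏ j ∈ Finset.range (m - k - 1), ((n : ℝ) + 2 * j))
      / (2 ^ k * (k.factorial : ℝ) * ((m - 2 * k).factorial : ℝ))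
      * inner ℝ x ξ ^ (m - 2 * k) * ‖x‖ ^ (2 * k)

/-- The extended zonal harmonic `Y_m(x, y) = |y|^m 𝒴_m(x, y/|y|)`; at `y = 0` it is `1` if `m = 0`
and `0` otherwise. -/
def zonalExt {n : ℕ} (m : ℕ) (x y : EuclideanSpace ℝ (Fin n)) : ℝ :=
  ‖y‖ ^ m * zonal m x (‖y‖⁻¹ • y)

/-- The harmonic Fock kernel `H_α(x, y) = ∑_k Y_k(x, y) / (α^k (n/2)_k)`, where `(a)_k` is the
rising factorial. -/
def kernel {n : ℕ} (α : ℝ) (x y : EuclideanSpace ℝ (Fin n)) : ℝ :=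
  ∑' k : ℕ, zonalExt k x y / (α ^ k * (ascPochhammer ℝ k).eval ((n : ℝ) / 2))

/-- The integral operator `P_α f(x) = ∫ H_α(x, y) f(y) dμ_α(y)`. -/
def proj {n : ℕ} {𝕜 : Type*} [RCLike 𝕜] (α : ℝ) (f : EuclideanSpace ℝ (Fin n) → 𝕜)
    (x : EuclideanSpace ℝ (Fin n)) : 𝕜 :=
  ∫ y, kernel α x y • f y ∂(gaussian n α)

/-- `f` lies in the natural domain of `P_α`: the integral defining `P_α f(x)` converges absolutely
for almost every `x`. -/
def InDomain {n : ℕ} {𝕜 : Type*} [RCLike 𝕜] (α : ℝ) (f : EuclideanSpace ℝ (Fin n) → 𝕜) : Prop :=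
  ∀ᵐ x : EuclideanSpace ℝ (Fin n), Integrable (fun y => kernel α x y • f y) (gaussian n α)

/-- `P_α` is bounded on `L^p(ℝⁿ, dμ_β)` (scalars `𝕜 = ℝ` or `ℂ`): for some constant `C`, every
`f ∈ L^p(dμ_β)` for which `P_α f` is defined has `P_α f ∈ L^p(dμ_β)` and `‖P_α f‖ ≤ C ‖f‖`.
It is not required that `P_α f` be defined for every `f ∈ L^p(dμ_β)`, so that this is implied by
boundedness of `P_α` as an operator defined on the whole space. -/
def BoundedOn (𝕜 : Type*) [RCLike 𝕜] (n : ℕ) (α β p : ℝ) : Prop :=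
  ∃ C : ℝ≥0, ∀ f : EuclideanSpace ℝ (Fin n) → 𝕜,
    MemLp f (ENNReal.ofReal p) (gaussian n β) → InDomain α f →
      MemLp (proj α f) (ENNReal.ofReal p) (gaussian n β) ∧
        eLpNorm (proj α f) (ENNReal.ofReal p) (gaussian n β)
          ≤ C * eLpNorm f (ENNReal.ofReal p) (gaussian n β)

end HarmonicFock

end

/-!
Let `G` be a homogeneous harmonic polynomial of degree `m`. Green's identity for the Gaussian
measure makes homogeneous harmonic functions of different degrees orthogonal and, by induction on
the degree of the monomials of the zonal harmonic, gives a reproducing formula; summing over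
degrees, `∫ H_α(x, ·) G dμ_γ = (γ/α)^m G(x)` for every `γ > 0`. As `exp (-s|y|²) dμ_α` is a multiple
of `dμ_γ` with `γ = α / (1 + sα)`, this says that `P_α` maps `exp (-s|y|²) G` to
`(1 + sα)^(-m-n/2) G`. Comparing `L^p` norms, boundedness gives
`(1 + psβ)^(m/2 + n/(2p)) ≤ C (1 + sα)^(m + n/2)` uniformly in `m` and `s`. Letting `m → ∞` forces
`1 + psβ ≤ (1 + sα)²`, with equality at `s = 0`, so the derivatives there agree: `pβ = 2α`. Then
`m = 0` and `s → ∞` force `n/(2p) ≤ n/2`, that is `1 ≤ p`.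
-/

noncomputable section

open InnerProductSpace
open scoped ContDiff Laplacian

namespace HarmonicFock

section Calculus

variable {E V A : Type*} [NormedAddCommGroup E] [NormedAddCommGroup V] [NormedSpace ℝ V]
  [NormedCommRing A] [NormedAlgebra ℝ A]

section NormedSpace

variable [NormedSpace ℝ E]

theorem hasTemperateGrowth_fderiv_apply {F : E → V} (hF : F.HasTemperateGrowth) (a : E) :
    (fun y => fderiv ℝ F y a).HasTemperateGrowth := by
  have hF' : (fderiv ℝ F).HasTemperateGrowth := by
    refine ⟨hF.1.fderiv_right (by simp), fun k => ?_⟩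
    obtain ⟨l, C, hC⟩ := hF.2 (k + 1)
    exact ⟨l, C, fun y => by simpa only [norm_iteratedFDeriv_fderiv] using hC y⟩
  exact (ContinuousLinearMap.apply ℝ V a).hasTemperateGrowth.comp hF'

theorem contDiff_fderiv_apply {F : E → V} (hF : ContDiff ℝ ∞ F) (a : E) :
    ContDiff ℝ ∞ fun y => fderiv ℝ F y a :=
  (hF.fderiv_right (by simp)).clm_apply contDiff_const

theorem differentiable_fderiv {F : E → V} (hF : ContDiff ℝ ∞ F) :
    Differentiable ℝ (fderiv ℝ F) :=
  (hF.fderiv_right (m := ∞) (by simp)).differentiable (by simp)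

theorem fderiv_fderiv_apply {F : E → V} (hF : ContDiff ℝ ∞ F) (y a b : E) :
    fderiv ℝ (fun z => fderiv ℝ F z a) y b = fderiv ℝ (fderiv ℝ F) y b a := by
  simp [fderiv_clm_apply (differentiable_fderiv hF y)]

theorem fderiv_fderiv_apply_comm {F : E → V} (hF : ContDiff ℝ ∞ F) (y a b : E) :
    fderiv ℝ (fun z => fderiv ℝ F z a) y b = fderiv ℝ (fun z => fderiv ℝ F z b) y a := by
  have hsymm : IsSymmSndFDerivAt ℝ F y := hF.contDiffAt.isSymmSndFDerivAt (by
    simp only [minSmoothness_of_isRCLikeNormedField]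
    norm_cast)
  simpa only [fderiv_fderiv_apply hF] using hsymm b a

theorem fderiv_pow_apply {F : E → A} (hF : ContDiff ℝ ∞ F) (k : ℕ) (y a : E) :
    fderiv ℝ (fun z => F z ^ k) y a = k * F y ^ (k - 1) * fderiv ℝ F y a := by
  simp [fderiv_fun_pow k (hF.differentiable (by simp) y), mul_assoc]

theorem euler_mul {F G : E → ℝ} (hF : Differentiable ℝ F) (hG : Differentiable ℝ G) {a b : ℝ}
    (hFa : ∀ y, fderiv ℝ F y y = a * F y) (hGb : ∀ y, fderiv ℝ G y y = b * G y) (y : E) :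
    fderiv ℝ (fun z => F z * G z) y y = (a + b) * (F y * G y) := by
  simp only [fderiv_fun_mul (hF y) (hG y), add_apply, smul_apply, smul_eq_mul, hFa, hGb]
  ring

theorem euler_pow {F : E → ℝ} (hF : ContDiff ℝ ∞ F) {a : ℝ}
    (hFa : ∀ y, fderiv ℝ F y y = a * F y) (k : ℕ) (y : E) :
    fderiv ℝ (fun z => F z ^ k) y y = k * a * F y ^ k := by
  rw [fderiv_pow_apply hF, hFa]
  cases k with
  | zero => simp
  | succ k =>
    rw [Nat.add_sub_cancel, pow_succ]
    ring

end NormedSpace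

variable [InnerProductSpace ℝ E]

theorem fderiv_inner_right_apply (x y a : E) : fderiv ℝ (fun z => inner ℝ x z) y a = inner ℝ x a :=
  congrArg (fun T => T a) ((innerSL ℝ x).fderiv (x := y))

theorem euler_inner_right_pow (x : E) (j : ℕ) (y : E) :
    fderiv ℝ (fun z => inner ℝ x z ^ j) y y = j * inner ℝ x y ^ j := by
  simpa using euler_pow (innerSL ℝ x).contDiff (a := 1) (by simp [fderiv_inner_right_apply]) j y

theorem euler_norm_sq_pow (l : ℕ) (y : E) :
    fderiv ℝ (fun z : E => (‖z‖ ^ 2) ^ l) y y = 2 * l * (‖y‖ ^ 2) ^ l := by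
  rw [euler_pow (contDiff_norm_sq ℝ) (a := 2) (by simp)]
  ring

theorem hasTemperateGrowth_inner_right_pow (x : E) (j : ℕ) :
    (fun y => inner ℝ x y ^ j).HasTemperateGrowth :=
  (innerSL ℝ x).hasTemperateGrowth.pow j

theorem hasTemperateGrowth_norm_sq_pow (l : ℕ) :
    (fun y : E => (‖y‖ ^ 2) ^ l).HasTemperateGrowth :=
  (Function.hasTemperateGrowth_norm_sq E).pow l

/-- The coefficient of `⟨x, y⟩ ^ (k - 2 * l) * (‖x‖ * ‖y‖) ^ (2 * l)` in `fockZonal k x y`, in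
dimension `n`. The recursion in `l` is the one that makes `fockZonal k x` harmonic; it yields `0`
once `k < 2 * l`. -/
def fockZonalCoeff (n k : ℕ) : ℕ → ℝ
  | 0 => 2 ^ k / k.factorial
  | l + 1 => -(((k : ℝ) - 2 * l) * (k - 2 * l - 1)) / (4 * (l + 1) * (n / 2 + k - 2 - l)) *
      fockZonalCoeff n k l

/-- The zonal harmonic `Y_k(x, y)` divided by `(n/2)_k`, with `n` the dimension of the space: the
`k`-th term of the harmonic Fock kernel for `α = 1`. -/
def fockZonal (k : ℕ) (x y : E) : ℝ :=
  ∑ l ∈ Finset.range (k / 2 + 1), fockZonalCoeff (Module.finrank ℝ E) k l * (‖x‖ ^ 2) ^ l *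
    (inner ℝ x y ^ (k - 2 * l) * (‖y‖ ^ 2) ^ l)

theorem fockZonalCoeff_succ_mul {n : ℕ} (hn : 0 < n) {k l : ℕ} (hl : 2 * l ≤ k) :
    4 * (l + 1) * (n / 2 + k - 2 - l) * fockZonalCoeff n k (l + 1) =
      -((k - 2 * l) * (k - 2 * l - 1)) * fockZonalCoeff n k l := by
  rw [fockZonalCoeff]
  obtain ⟨d, rfl⟩ := Nat.exists_eq_add_of_le hl
  rcases d with _ | _ | d
  · simp
  · simp
  · have hn' : (0 : ℝ) < n := by exact_mod_cast hn
    have hpos : 0 < (n : ℝ) / 2 + (2 * l + (d + 1 + 1) : ℕ) - 2 - l := by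
      push_cast
      linarith [(Nat.cast_nonneg l : (0 : ℝ) ≤ l), (Nat.cast_nonneg d : (0 : ℝ) ≤ d)]
    rw [← mul_assoc, mul_div_cancel₀ _ (by positivity)]

theorem euler_fockZonal (k : ℕ) (x y : E) :
    fderiv ℝ (fockZonal k x) y y = k * fockZonal k x y := by
  have hdiff (l) : Differentiable ℝ fun y => inner ℝ x y ^ (k - 2 * l) * (‖y‖ ^ 2) ^ l :=
    ((hasTemperateGrowth_inner_right_pow x _).mul
      (hasTemperateGrowth_norm_sq_pow l)).1.differentiable (by simp)
  unfold fockZonal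
  rw [fderiv_fun_sum fun l _ => ((hdiff l).const_mul _) y, sum_apply, Finset.mul_sum]
  refine Finset.sum_congr rfl fun l hl => ?_
  have hdeg : ((k - 2 * l : ℕ) : ℝ) + 2 * l = k := by
    have : 2 * l ≤ k := by have := Finset.mem_range.mp hl; omega
    push_cast [this]
    ring
  rw [fderiv_const_mul (hdiff l y), smul_apply, smul_eq_mul,
    euler_mul ((hasTemperateGrowth_inner_right_pow x _).1.differentiable (by simp))
      ((hasTemperateGrowth_norm_sq_pow l).1.differentiable (by simp))
      (euler_inner_right_pow x _) (euler_norm_sq_pow l), hdeg]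
  ring

variable [FiniteDimensional ℝ E] {ι : Type*} [Fintype ι]

theorem laplacian_eq_sum_fderiv (e : OrthonormalBasis ι ℝ E) {F : E → V} (hF : ContDiff ℝ ∞ F)
    (y : E) : Δ F y = ∑ i, fderiv ℝ (fun z => fderiv ℝ F z (e i)) y (e i) := by
  simp [laplacian_eq_iteratedFDeriv_orthonormalBasis F e, iteratedFDeriv_two_apply,
    fderiv_fderiv_apply hF]

theorem laplacian_fderiv_apply {F : E → V} (hF : ContDiff ℝ ∞ F) (y a : E) :
    Δ (fun z => fderiv ℝ F z a) y = fderiv ℝ (Δ F) y a := by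
  let e := stdOrthonormalBasis ℝ E
  have smooth (b : E) := contDiff_fderiv_apply hF b
  rw [laplacian_eq_sum_fderiv e (smooth a), funext (laplacian_eq_sum_fderiv e hF),
    fderiv_fun_sum fun i _ => (contDiff_fderiv_apply (smooth _) _).differentiable (by simp) y,
    sum_apply]
  refine Finset.sum_congr rfl fun i _ => ?_
  simp only [fderiv_fderiv_apply_comm hF _ a]
  exact fderiv_fderiv_apply_comm (smooth _) y a (e i)

theorem laplacian_mul (e : OrthonormalBasis ι ℝ E) {F G : E → A} (hF : ContDiff ℝ ∞ F)
    (hG : ContDiff ℝ ∞ G) (y : E) :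
    Δ (fun z => F z * G z) y = F y * Δ G y + Δ F y * G y +
      2 * ∑ i, fderiv ℝ F y (e i) * fderiv ℝ G y (e i) := by
  have hF₁ := hF.differentiable (by simp)
  have hG₁ := hG.differentiable (by simp)
  have hF₂ (i) := (contDiff_fderiv_apply hF (e i)).differentiable (by simp)
  have hG₂ (i) := (contDiff_fderiv_apply hG (e i)).differentiable (by simp)
  rw [laplacian_eq_sum_fderiv e (hF.mul hG), laplacian_eq_sum_fderiv e hF,
    laplacian_eq_sum_fderiv e hG, Finset.mul_sum, Finset.sum_mul, Finset.mul_sum,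
    ← Finset.sum_add_distrib, ← Finset.sum_add_distrib]
  refine Finset.sum_congr rfl fun i _ => ?_
  have hFG (z : E) : fderiv ℝ (fun z => F z * G z) z (e i) =
      F z * fderiv ℝ G z (e i) + G z * fderiv ℝ F z (e i) := by
    simp [fderiv_fun_mul (hF₁ z) (hG₁ z)]
  rw [funext hFG, fderiv_fun_add ((hF₁ y).fun_mul (hG₂ i y)) ((hG₁ y).fun_mul (hF₂ i y)),
    fderiv_fun_mul (hF₁ y) (hG₂ i y), fderiv_fun_mul (hG₁ y) (hF₂ i y)]
  simp only [add_apply, smul_apply, smul_eq_mul]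
  ring

theorem laplacian_pow (e : OrthonormalBasis ι ℝ E) {F : E → A} (hF : ContDiff ℝ ∞ F) (k : ℕ)
    (y : E) :
    Δ (fun z => F z ^ k) y = k * F y ^ (k - 1) * Δ F y +
      k * (k - 1) * F y ^ (k - 2) * ∑ i, fderiv ℝ F y (e i) ^ 2 := by
  induction k with
  | zero => simp [laplacian_const]
  | succ k ih =>
    simp only [pow_succ]
    rw [laplacian_mul e (hF.pow k) hF, ih]
    simp only [fderiv_pow_apply hF, mul_assoc, ← Finset.mul_sum, ← sq]
    rcases k with _ | _ | k
    · simp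
    · norm_num
      ring
    · simp only [pow_succ, pow_zero, one_mul, Nat.add_sub_cancel, Nat.cast_add, Nat.cast_one,
        add_sub_cancel_right, Nat.reduceSubDiff]
      ring

theorem laplacian_norm_sq (y : E) : Δ (fun z : E => ‖z‖ ^ 2) y = 2 * Module.finrank ℝ E := by
  let e := stdOrthonormalBasis ℝ E
  have h (i) : fderiv ℝ (fun z : E => 2 * inner ℝ z (e i)) y (e i) = 2 := by
    simp only [real_inner_comm (e i), ← innerSL_apply_apply ℝ (e i)]
    rw [fderiv_const_mul (by fun_prop), ContinuousLinearMap.fderiv]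
    simp
  simp [laplacian_eq_sum_fderiv e (contDiff_norm_sq ℝ), h, mul_comm]

/-- A solid harmonic of degree `m`: a harmonic function that is homogeneous of degree `m`, the
homogeneity being expressed by Euler's identity. Temperate growth makes it integrable against
Gaussian measures. -/
structure IsSolidHarmonic (m : ℕ) (G : E → ℝ) : Prop where
  hasTemperateGrowth : G.HasTemperateGrowth
  euler (y : E) : fderiv ℝ G y y = m * G y
  laplacian_eq_zero (y : E) : Δ G y = 0

namespace IsSolidHarmonic

variable {m : ℕ} {G : E → ℝ}

theorem contDiff (hG : IsSolidHarmonic m G) : ContDiff ℝ ∞ G :=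
  hG.hasTemperateGrowth.1

theorem euler_fderiv (hG : IsSolidHarmonic m G) (y a : E) :
    fderiv ℝ (fun z => fderiv ℝ G z a) y y = (m - 1) * fderiv ℝ G y a := by
  have h : fderiv ℝ (fun z => fderiv ℝ G z z) y a = fderiv ℝ (fun z => m * G z) y a := by
    rw [funext hG.euler]
  rw [fderiv_clm_apply (differentiable_fderiv hG.contDiff y) differentiableAt_fun_id,
    fderiv_const_mul (hG.contDiff.differentiable (by simp) y)] at h
  simp only [fderiv_fun_id, ContinuousLinearMap.comp_id, add_apply,
    ContinuousLinearMap.flip_apply, smul_apply, smul_eq_mul] at h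
  rw [fderiv_fderiv_apply_comm hG.contDiff, fderiv_fderiv_apply hG.contDiff]
  linarith

theorem fderiv_apply (hG : IsSolidHarmonic (m + 1) G) (a : E) :
    IsSolidHarmonic m fun y => fderiv ℝ G y a where
  hasTemperateGrowth := hasTemperateGrowth_fderiv_apply hG.hasTemperateGrowth a
  euler y := by simpa using hG.euler_fderiv y a
  laplacian_eq_zero y := by
    simp [laplacian_fderiv_apply hG.contDiff, funext hG.laplacian_eq_zero]

theorem hasDerivAt_comp_smul (hG : IsSolidHarmonic m G) (r : ℝ) (y : E) :
    HasDerivAt (fun r : ℝ => G (r • y)) (fderiv ℝ G (r • y) y) r := by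
  have h := (hG.contDiff.differentiable (by simp) (r • y)).hasFDerivAt.comp_hasDerivAt r
    ((hasDerivAt_id r).smul_const y)
  rwa [one_smul] at h

theorem map_smul (hG : IsSolidHarmonic m G) (r : ℝ) (y : E) : G (r • y) = r ^ m * G y := by
  induction m generalizing G r with
  | zero =>
    suffices h : ∀ r : ℝ, fderiv ℝ G (r • y) y = 0 by
      simpa using is_const_of_deriv_eq_zero
        (fun r => (hG.hasDerivAt_comp_smul r y).differentiableAt)
        (fun r => (hG.hasDerivAt_comp_smul r y).deriv.trans (h r)) r 1
    intro r
    rcases eq_or_ne r 0 with rfl | hr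
    · simpa using hG.euler_fderiv 0 y
    · simpa [hr] using hG.euler (r • y)
  | succ m ih =>
    have hderiv (r : ℝ) : HasDerivAt (fun r : ℝ => G (r • y) - r ^ (m + 1) * G y) 0 r := by
      refine ((hG.hasDerivAt_comp_smul r y).sub
        ((hasDerivAt_pow (m + 1) r).mul_const (G y))).congr_deriv ?_
      rw [ih (hG.fderiv_apply y) r, hG.euler]
      simp only [Nat.add_sub_cancel]
      ring
    have := is_const_of_deriv_eq_zero (fun r => (hderiv r).differentiableAt)
      (fun r => (hderiv r).deriv) r 1
    simpa [sub_eq_zero] using this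

theorem of_zero_eq (hG : IsSolidHarmonic 0 G) (y : E) : G y = G 0 := by
  simpa using (hG.map_smul 0 y).symm

end IsSolidHarmonic

theorem laplacian_continuousLinearMap (L : E →L[ℝ] V) (y : E) : Δ (fun z => L z) y = 0 := by
  simp [laplacian_eq_sum_fderiv (stdOrthonormalBasis ℝ E) L.contDiff]

theorem isSolidHarmonic_re_pow (e : OrthonormalBasis ι ℝ E) {L : E →L[ℝ] ℂ}
    (hL : ∑ i, L (e i) ^ 2 = 0) (m : ℕ) : IsSolidHarmonic m fun y => (L y ^ m).re where
  hasTemperateGrowth :=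
    Complex.reCLM.hasTemperateGrowth.comp (L.hasTemperateGrowth.pow m)
  euler y := by
    have h := (Complex.reCLM.hasFDerivAt (x := L y ^ m)).comp y (L.hasFDerivAt.pow m)
    have hm : (m : ℂ) * L y ^ (m - 1) * L y = m * L y ^ m := by
      cases m <;> simp [pow_succ, mul_assoc]
    have h' : fderiv ℝ (fun z => (L z ^ m).re) y y = ((m : ℂ) * L y ^ (m - 1) * L y).re := by
      simpa [Function.comp_def, mul_assoc] using congrArg (fun T => T y) h.fderiv
    rw [h', hm, ← Complex.ofReal_natCast, Complex.re_ofReal_mul]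
  laplacian_eq_zero y := by
    have h := ((L.contDiff (n := 2)).pow m).contDiffAt (x := y) |>.laplacian_CLM_comp_left
      (l := Complex.reCLM)
    refine h.trans ?_
    have h' : Δ (fun z => L z ^ m) y = 0 := by
      simp [laplacian_pow e L.contDiff, laplacian_continuousLinearMap, hL]
    simpa using congrArg Complex.re h'

theorem exists_isSolidHarmonic_ne_zero (hE : 2 ≤ Module.finrank ℝ E) (m : ℕ) :
    ∃ (G : E → ℝ) (y : E), IsSolidHarmonic m G ∧ G y ≠ 0 := by
  let e := stdOrthonormalBasis ℝ E
  let a := e ⟨0, by omega⟩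
  let b := e ⟨1, by omega⟩
  let L : E →L[ℝ] ℂ :=
    Complex.ofRealCLM ∘L innerSL ℝ a + Complex.I • (Complex.ofRealCLM ∘L innerSL ℝ b)
  have hL (y : E) : L y = inner ℝ a y + Complex.I * inner ℝ b y := by simp [L]
  have hab : inner ℝ a b = 0 := e.orthonormal.2 (by simp)
  have hba : inner ℝ b a = 0 := e.orthonormal.2 (by simp)
  have ha : inner ℝ a a = 1 := by simp [a]
  have hsum : ∑ i, L (e i) ^ 2 = 0 := by
    have expand (i) : L (e i) ^ 2 = (inner ℝ a (e i) ^ 2 : ℝ) - (inner ℝ b (e i) ^ 2 : ℝ) +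
        2 * Complex.I * (inner ℝ a (e i) * inner ℝ (e i) b : ℝ) := by
      rw [hL, real_inner_comm b]
      push_cast
      linear_combination (inner ℝ b (e i) : ℂ) ^ 2 * Complex.I_sq
    simp only [expand, Finset.sum_add_distrib, Finset.sum_sub_distrib, ← Finset.mul_sum,
      ← Complex.ofReal_sum, e.sum_inner_mul_inner, e.sum_sq_inner_left, hab]
    simp [a, b]
  refine ⟨_, a, isSolidHarmonic_re_pow e hsum m, ?_⟩
  rw [hL, ha, hba]
  simp

theorem laplacian_inner_right_pow (x y : E) (j : ℕ) :
    Δ (fun z => inner ℝ x z ^ j) y = j * (j - 1) * ‖x‖ ^ 2 * inner ℝ x y ^ (j - 2) := by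
  have hΔ : Δ (fun z => inner ℝ x z) y = 0 := laplacian_continuousLinearMap (innerSL ℝ x) y
  have hx : ContDiff ℝ ∞ fun z => inner ℝ x z := (innerSL ℝ x).contDiff
  rw [laplacian_pow (stdOrthonormalBasis ℝ E) hx, hΔ]
  simp only [fderiv_inner_right_apply, OrthonormalBasis.sum_sq_inner_left]
  ring

theorem laplacian_norm_sq_pow (y : E) (l : ℕ) :
    Δ (fun z : E => (‖z‖ ^ 2) ^ l) y =
      2 * l * (2 * l - 2 + Module.finrank ℝ E) * (‖y‖ ^ 2) ^ (l - 1) := by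
  have hgrad (a : E) : fderiv ℝ (fun z : E => ‖z‖ ^ 2) y a ^ 2 = 4 * inner ℝ y a ^ 2 := by
    simp only [fderiv_norm_sq_apply, smul_apply, innerSL_apply_apply, nsmul_eq_mul]
    ring
  rw [laplacian_pow (stdOrthonormalBasis ℝ E) (contDiff_norm_sq ℝ), laplacian_norm_sq]
  simp only [hgrad, ← Finset.mul_sum, OrthonormalBasis.sum_sq_inner_left]
  rcases l with _ | _ | l
  · simp
  · simp
  · simp only [Nat.add_sub_cancel, pow_succ]
    push_cast
    ring

theorem laplacian_inner_right_pow_mul_norm_sq_pow (x y : E) (j l : ℕ) :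
    Δ (fun z => inner ℝ x z ^ j * (‖z‖ ^ 2) ^ l) y =
      j * (j - 1) * ‖x‖ ^ 2 * (inner ℝ x y ^ (j - 2) * (‖y‖ ^ 2) ^ l) +
        2 * l * (2 * j + 2 * l - 2 + Module.finrank ℝ E) *
          (inner ℝ x y ^ j * (‖y‖ ^ 2) ^ (l - 1)) := by
  let e := stdOrthonormalBasis ℝ E
  have hx : ContDiff ℝ ∞ fun z => inner ℝ x z := (innerSL ℝ x).contDiff
  have hN : ContDiff ℝ ∞ fun z : E => ‖z‖ ^ 2 := contDiff_norm_sq ℝ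
  have hcross : ∑ i, fderiv ℝ (fun z => inner ℝ x z ^ j) y (e i) *
      fderiv ℝ (fun z => (‖z‖ ^ 2) ^ l) y (e i) =
        2 * j * l * (inner ℝ x y ^ (j - 1) * inner ℝ x y) * (‖y‖ ^ 2) ^ (l - 1) := by
    simp only [← e.sum_inner_mul_inner x y, real_inner_comm y (e _), fderiv_pow_apply hx,
      fderiv_pow_apply hN, fderiv_inner_right_apply, fderiv_norm_sq_apply, smul_apply,
      innerSL_apply_apply, nsmul_eq_mul, Finset.mul_sum, Finset.sum_mul]
    exact Finset.sum_congr rfl fun i _ => by push_cast; ring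
  rw [laplacian_mul e (hx.pow j) (hN.pow l), laplacian_inner_right_pow, laplacian_norm_sq_pow,
    hcross]
  rcases j with _ | j
  · simp only [pow_zero, Nat.cast_zero]
    ring
  · simp only [Nat.add_sub_cancel, pow_succ]
    ring

theorem laplacian_sum_const_mul {κ : Type*} (s : Finset κ) (c : κ → ℝ) {F : κ → E → ℝ}
    (hF : ∀ i ∈ s, ContDiff ℝ ∞ (F i)) (y : E) :
    Δ (fun z => ∑ i ∈ s, c i * F i z) y = ∑ i ∈ s, c i * Δ (F i) y := by
  classical
  induction s using Finset.induction_on with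
  | empty => simp [laplacian_const]
  | insert i s hi ih =>
    have hF' (j) (hj : j ∈ insert i s) : ContDiff ℝ 2 fun z => c j * F j z :=
      contDiff_const.mul ((hF j hj).of_le (by norm_cast))
    simp only [Finset.sum_insert hi]
    rw [← ih fun j hj => hF j (Finset.mem_insert_of_mem hj)]
    refine (ContDiffAt.laplacian_add (hF' i (Finset.mem_insert_self i s)).contDiffAt
      (ContDiff.sum fun j hj => hF' j (Finset.mem_insert_of_mem hj)).contDiffAt).trans ?_
    congr 1
    exact laplacian_smul (c i)
      ((hF i (Finset.mem_insert_self i s)).of_le (by norm_cast)).contDiffAt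

theorem laplacian_fockZonal [Nontrivial E] (k : ℕ) (x y : E) : Δ (fockZonal k x) y = 0 := by
  let n := Module.finrank ℝ E
  let b (l : ℕ) := fockZonalCoeff n k l * (‖x‖ ^ 2) ^ l *
    (4 * l * (n / 2 + k - 1 - l) * (inner ℝ x y ^ (k - 2 * l) * (‖y‖ ^ 2) ^ (l - 1)))
  have hterm (l) (hl : l ∈ Finset.range (k / 2 + 1)) :
      fockZonalCoeff n k l * (‖x‖ ^ 2) ^ l *
        Δ (fun z => inner ℝ x z ^ (k - 2 * l) * (‖z‖ ^ 2) ^ l) y = b l - b (l + 1) := by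
    have hlk : 2 * l ≤ k := by have := Finset.mem_range.mp hl; omega
    have hrec := fockZonalCoeff_succ_mul (n := n) Module.finrank_pos hlk
    simp only [b, laplacian_inner_right_pow_mul_norm_sq_pow, Nat.sub_sub, mul_add_one,
      Nat.add_sub_cancel, Nat.cast_sub hlk]
    push_cast
    linear_combination ((‖x‖ ^ 2) ^ (l + 1) * (inner ℝ x y ^ (k - (2 * l + 2)) * (‖y‖ ^ 2) ^ l)) *
      hrec
  have hb₀ : b 0 = 0 := by simp [b]
  have hb : b (k / 2 + 1) = 0 := by
    have hrec := fockZonalCoeff_succ_mul (n := n) Module.finrank_pos (Nat.mul_div_le k 2)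
    have hk : ((k : ℝ) - 2 * (k / 2 : ℕ)) * (k - 2 * (k / 2 : ℕ) - 1) = 0 := by
      rcases Nat.even_or_odd' k with ⟨d, rfl | rfl⟩
      · simp
      · simp [Nat.mul_add_div]
    rw [hk] at hrec
    simp only [b, Nat.cast_add_one]
    linear_combination ((‖x‖ ^ 2) ^ (k / 2 + 1) * (inner ℝ x y ^ (k - 2 * (k / 2 + 1)) *
      (‖y‖ ^ 2) ^ (k / 2 + 1 - 1))) * hrec
  unfold fockZonal
  rw [laplacian_sum_const_mul, Finset.sum_congr rfl hterm, Finset.sum_range_sub', hb₀, hb, sub_self]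
  exact fun l _ => ((hasTemperateGrowth_inner_right_pow x _).mul
    (hasTemperateGrowth_norm_sq_pow l)).1

theorem isSolidHarmonic_fockZonal [Nontrivial E] (k : ℕ) (x : E) :
    IsSolidHarmonic k (fockZonal k x) where
  hasTemperateGrowth := .sum fun l _ => .mul (.const _)
    ((hasTemperateGrowth_inner_right_pow x _).mul (hasTemperateGrowth_norm_sq_pow l))
  euler := euler_fockZonal k x
  laplacian_eq_zero := laplacian_fockZonal k x

end Calculus

section Gaussian

variable {n : ℕ} {γ : ℝ} {F : EuclideanSpace ℝ (Fin n) → ℝ}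

theorem integrable_exp_neg_mul_norm_sq_add {t : ℝ} (ht : 0 < t) (B : ℝ) :
    Integrable fun y : EuclideanSpace ℝ (Fin n) => Real.exp (-t * ‖y‖ ^ 2 + B * ‖y‖) := by
  have hint : Integrable fun y : EuclideanSpace ℝ (Fin n) => Real.exp (-(t / 2) * ‖y‖ ^ 2) := by
    refine .of_integral_ne_zero ?_
    rw [GaussianFourier.integral_rexp_neg_mul_sq_norm (half_pos ht)]
    positivity
  refine (hint.const_mul (Real.exp (B ^ 2 / (2 * t)))).mono'
    (Continuous.aestronglyMeasurable (by fun_prop)) (.of_forall fun y => ?_)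
  have hsq : B ^ 2 / (2 * t) + -(t / 2) * ‖y‖ ^ 2 - (-t * ‖y‖ ^ 2 + B * ‖y‖) =
      (t * ‖y‖ - B) ^ 2 / (2 * t) := by
    field_simp
    ring
  rw [Real.norm_of_nonneg (Real.exp_pos _).le, ← Real.exp_add, Real.exp_le_exp, ← sub_nonneg, hsq]
  positivity

theorem measurable_gaussian_density (γ : ℝ) : Measurable fun y : EuclideanSpace ℝ (Fin n) =>
    ENNReal.ofReal ((Real.pi * γ) ^ (-(n : ℝ) / 2) * Real.exp (-‖y‖ ^ 2 / γ)) := by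
  fun_prop

theorem toReal_gaussian_density (hγ : 0 < γ) (y : EuclideanSpace ℝ (Fin n)) :
    (ENNReal.ofReal ((Real.pi * γ) ^ (-(n : ℝ) / 2) * Real.exp (-‖y‖ ^ 2 / γ))).toReal =
      (Real.pi * γ) ^ (-(n : ℝ) / 2) * Real.exp (-γ⁻¹ * ‖y‖ ^ 2) := by
  rw [ENNReal.toReal_ofReal (by positivity)]
  congr 2
  field_simp

theorem integral_gaussian (hγ : 0 < γ) (F : EuclideanSpace ℝ (Fin n) → ℝ) :
    ∫ y, F y ∂gaussian n γ =
      (Real.pi * γ) ^ (-(n : ℝ) / 2) * ∫ y, Real.exp (-γ⁻¹ * ‖y‖ ^ 2) * F y := by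
  rw [gaussian, integral_withDensity_eq_integral_toReal_smul (measurable_gaussian_density γ)
    (.of_forall fun _ => ENNReal.ofReal_lt_top), ← integral_const_mul]
  simp only [toReal_gaussian_density hγ, smul_eq_mul, mul_assoc]

theorem integrable_gaussian_iff (hγ : 0 < γ) :
    Integrable F (gaussian n γ) ↔ Integrable fun y => Real.exp (-γ⁻¹ * ‖y‖ ^ 2) * F y := by
  have hconst : (Real.pi * γ) ^ (-(n : ℝ) / 2) ≠ 0 := by positivity
  rw [gaussian, integrable_withDensity_iff_integrable_smul' (measurable_gaussian_density γ)
    (.of_forall fun _ => ENNReal.ofReal_lt_top)]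
  simp only [toReal_gaussian_density hγ, smul_eq_mul, mul_assoc]
  exact integrable_const_mul_iff hconst.isUnit _

theorem isProbabilityMeasure_gaussian (hγ : 0 < γ) : IsProbabilityMeasure (gaussian n γ) := by
  have hmass : (gaussian n γ).real Set.univ = 1 := by
    rw [← mul_one ((gaussian n γ).real _), ← smul_eq_mul, ← integral_const, integral_gaussian hγ]
    simp only [mul_one, GaussianFourier.integral_rexp_neg_mul_sq_norm (inv_pos.mpr hγ),
      finrank_euclideanSpace_fin, div_inv_eq_mul]
    rw [← Real.rpow_add (by positivity), neg_div, neg_add_cancel, Real.rpow_zero]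
  exact ⟨by rwa [measureReal_def, ENNReal.toReal_eq_one_iff] at hmass⟩

theorem integrable_exp_mul_norm_mul (hγ : 0 < γ) (B : ℝ) (hF : F.HasTemperateGrowth) :
    Integrable (fun y => Real.exp (B * ‖y‖) * F y) (gaussian n γ) := by
  obtain ⟨k, C, hC⟩ := hF.2 0
  have hbound (y) : ‖F y‖ ≤ k.factorial * C * Real.exp (1 + ‖y‖) := by
    have hC₀ : 0 ≤ C := by simpa using (norm_nonneg _).trans (hC 0)
    calc ‖F y‖ ≤ C * (1 + ‖y‖) ^ k := by simpa using hC y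
      _ ≤ C * (k.factorial * Real.exp (1 + ‖y‖)) := by
        gcongr
        rw [← div_le_iff₀' (by positivity)]
        exact Real.pow_div_factorial_le_exp _ (by positivity) k
      _ = _ := by ring
  have hcont := hF.1.continuous
  rw [integrable_gaussian_iff hγ]
  refine ((integrable_exp_neg_mul_norm_sq_add (inv_pos.mpr hγ) (B + 1)).const_mul
    (k.factorial * C * Real.exp 1)).mono' (Continuous.aestronglyMeasurable (by fun_prop))
    (.of_forall fun y => ?_)
  simp only [norm_mul, Real.norm_of_nonneg (Real.exp_pos _).le]
  calc Real.exp (-γ⁻¹ * ‖y‖ ^ 2) * (Real.exp (B * ‖y‖) * ‖F y‖)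
      ≤ Real.exp (-γ⁻¹ * ‖y‖ ^ 2) *
        (Real.exp (B * ‖y‖) * (k.factorial * C * Real.exp (1 + ‖y‖))) := by
        gcongr
        exact hbound y
    _ = _ := by
        simp only [Real.exp_add, add_mul, one_mul]
        ring

theorem integrable_of_hasTemperateGrowth (hγ : 0 < γ) (hF : F.HasTemperateGrowth) :
    Integrable F (gaussian n γ) := by
  simpa using integrable_exp_mul_norm_mul hγ 0 hF

theorem integral_inner_mul_gaussian (hγ : 0 < γ) (hF : F.HasTemperateGrowth)
    (a : EuclideanSpace ℝ (Fin n)) :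
    ∫ y, inner ℝ a y * F y ∂gaussian n γ = γ / 2 * ∫ y, fderiv ℝ F y a ∂gaussian n γ := by
  let w : EuclideanSpace ℝ (Fin n) → ℝ := fun y => Real.exp (-γ⁻¹ * ‖y‖ ^ 2)
  have hw (y) : HasFDerivAt w (w y • (-γ⁻¹ • (2 • innerSL ℝ y))) y :=
    ((hasStrictFDerivAt_norm_sq y).hasFDerivAt.const_mul (-γ⁻¹)).exp
  have hw' (y) : fderiv ℝ w y a * F y = -2 * γ⁻¹ * (w y * (inner ℝ a y * F y)) := by
    simp only [(hw y).fderiv, smul_apply, innerSL_apply_apply, smul_eq_mul, nsmul_eq_mul,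
      real_inner_comm y a]
    ring
  have integrable_mul {G : EuclideanSpace ℝ (Fin n) → ℝ} (hG : G.HasTemperateGrowth) :
      Integrable fun y => w y * G y :=
    (integrable_gaussian_iff hγ).mp (integrable_of_hasTemperateGrowth hγ hG)
  have hparts : ∫ y, w y * fderiv ℝ F y a = -∫ y, fderiv ℝ w y a * F y := by
    refine integral_mul_fderiv_eq_neg_fderiv_mul_of_integrable ?_
      (integrable_mul (hasTemperateGrowth_fderiv_apply hF a)) (integrable_mul hF)
      (fun y _ => (hw y).differentiableAt) (fun y _ => hF.1.differentiable (by simp) y)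
    simp only [hw']
    exact (integrable_mul ((Function.hasTemperateGrowth_inner_right a).mul hF)).const_mul _
  simp only [hw', integral_const_mul] at hparts
  have hγ' : γ⁻¹ * γ = 1 := inv_mul_cancel₀ hγ.ne'
  rw [integral_gaussian hγ, integral_gaussian hγ, hparts]
  linear_combination (-(Real.pi * γ) ^ (-(n : ℝ) / 2) * ∫ y, w y * (inner ℝ a y * F y)) * hγ'

theorem integral_mul_fderiv_self_gaussian (hγ : 0 < γ) {ι : Type*} [Fintype ι]
    (e : OrthonormalBasis ι ℝ (EuclideanSpace ℝ (Fin n))) {G : EuclideanSpace ℝ (Fin n) → ℝ}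
    (hF : F.HasTemperateGrowth) (hG : G.HasTemperateGrowth) :
    ∫ y, F y * fderiv ℝ G y y ∂gaussian n γ = γ / 2 *
      ∫ y, (∑ i, fderiv ℝ F y (e i) * fderiv ℝ G y (e i) + F y * Δ G y) ∂gaussian n γ := by
  have hG' (i) := hasTemperateGrowth_fderiv_apply hG (e i)
  have hFG (i) : (fun y => F y * fderiv ℝ G y (e i)).HasTemperateGrowth := hF.mul (hG' i)
  have hFG' (i) : (fun y => inner ℝ (e i) y * (F y * fderiv ℝ G y (e i))).HasTemperateGrowth :=
    (Function.hasTemperateGrowth_inner_right (e i)).mul (hFG i)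
  have hsum (y) : F y * fderiv ℝ G y y = ∑ i, inner ℝ (e i) y * (F y * fderiv ℝ G y (e i)) := by
    conv_lhs => rw [← e.sum_repr' y, map_sum, e.sum_repr' y, Finset.mul_sum]
    simp only [_root_.map_smul, smul_eq_mul, mul_left_comm (F y)]
  have hfderiv (y) (i) : fderiv ℝ (fun z => F z * fderiv ℝ G z (e i)) y (e i) =
      fderiv ℝ F y (e i) * fderiv ℝ G y (e i) +
        F y * fderiv ℝ (fun z => fderiv ℝ G z (e i)) y (e i) := by
    rw [fderiv_fun_mul (hF.1.differentiable (by simp) y) ((hG' i).1.differentiable (by simp) y)]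
    simp only [add_apply, smul_apply, smul_eq_mul]
    ring
  simp only [hsum]
  rw [integral_finsetSum _ fun i _ => integrable_of_hasTemperateGrowth hγ (hFG' i)]
  simp only [integral_inner_mul_gaussian hγ (hFG _), ← Finset.mul_sum]
  rw [← integral_finsetSum _ fun i _ => integrable_of_hasTemperateGrowth hγ
    (hasTemperateGrowth_fderiv_apply (hFG i) (e i))]
  simp only [hfderiv, Finset.sum_add_distrib, laplacian_eq_sum_fderiv e hG.1, Finset.mul_sum]

theorem integral_norm_sq_mul_gaussian (hγ : 0 < γ) (hF : F.HasTemperateGrowth) {d : ℝ}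
    (hd : ∀ y, fderiv ℝ F y y = d * F y) :
    ∫ y, ‖y‖ ^ 2 * F y ∂gaussian n γ = γ / 2 * (n + d) * ∫ y, F y ∂gaussian n γ := by
  let e := EuclideanSpace.basisFun (Fin n) ℝ
  have hgrad (y) : ∑ i, fderiv ℝ F y (e i) * fderiv ℝ (fun z => ‖z‖ ^ 2) y (e i) =
      2 * (d * F y) := by
    conv_rhs => rw [← hd, ← e.sum_repr' y, map_sum, e.sum_repr' y, Finset.mul_sum]
    simp only [fderiv_norm_sq_apply, smul_apply, innerSL_apply_apply, nsmul_eq_mul,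
      _root_.map_smul, smul_eq_mul, real_inner_comm]
    exact Finset.sum_congr rfl fun i _ => by push_cast; ring
  have hgreen := integral_mul_fderiv_self_gaussian hγ e hF
    (Function.hasTemperateGrowth_norm_sq (EuclideanSpace ℝ (Fin n)))
  have hlhs (y : EuclideanSpace ℝ (Fin n)) :
      F y * fderiv ℝ (fun z => ‖z‖ ^ 2) y y = 2 * (‖y‖ ^ 2 * F y) := by
    simp only [fderiv_norm_sq_apply, smul_apply, innerSL_apply_apply, nsmul_eq_mul,
      real_inner_self_eq_norm_sq]
    push_cast
    ring
  have hrhs (y : EuclideanSpace ℝ (Fin n)) :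
      2 * (d * F y) + F y * (2 * n) = 2 * (n + d) * F y := by ring
  simp only [hgrad, hlhs, hrhs, laplacian_norm_sq, finrank_euclideanSpace_fin,
    integral_const_mul] at hgreen
  linarith

theorem integral_mul_norm_sq_pow_gaussian_eq_zero (hγ : 0 < γ) (hF : F.HasTemperateGrowth) {d : ℝ}
    (hd : ∀ y, fderiv ℝ F y y = d * F y) (h₀ : ∫ y, F y ∂gaussian n γ = 0) (l : ℕ) :
    ∫ y, F y * (‖y‖ ^ 2) ^ l ∂gaussian n γ = 0 := by
  induction l with
  | zero => simpa using h₀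
  | succ l ih =>
    have hl := hasTemperateGrowth_norm_sq_pow (E := EuclideanSpace ℝ (Fin n)) l
    have h := integral_norm_sq_mul_gaussian hγ (hF.mul hl) fun y =>
      euler_mul (hF.1.differentiable (by simp)) (hl.1.differentiable (by simp)) hd
        (euler_norm_sq_pow l) y
    simp only [Pi.mul_apply, ih, mul_zero] at h
    simpa only [pow_succ', mul_left_comm (F _)] using h

namespace IsSolidHarmonic

variable {k m : ℕ} {G : EuclideanSpace ℝ (Fin n) → ℝ}

theorem mul_integral_mul (hγ : 0 < γ) {ι : Type*} [Fintype ι]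
    (e : OrthonormalBasis ι ℝ (EuclideanSpace ℝ (Fin n))) (hF : F.HasTemperateGrowth)
    (hG : IsSolidHarmonic m G) :
    m * ∫ y, F y * G y ∂gaussian n γ =
      γ / 2 * ∫ y, ∑ i, fderiv ℝ F y (e i) * fderiv ℝ G y (e i) ∂gaussian n γ := by
  have h := integral_mul_fderiv_self_gaussian hγ e hF hG.hasTemperateGrowth
  simpa only [hG.euler, hG.laplacian_eq_zero, mul_zero, add_zero, mul_left_comm (F _),
    integral_const_mul] using h

theorem integral_mul_eq_zero (hγ : 0 < γ) (hF : IsSolidHarmonic k F) (hG : IsSolidHarmonic m G)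
    (hkm : k ≠ m) : ∫ y, F y * G y ∂gaussian n γ = 0 := by
  let e := EuclideanSpace.basisFun (Fin n) ℝ
  have hFG := hG.mul_integral_mul hγ e hF.hasTemperateGrowth
  have hGF := hF.mul_integral_mul hγ e hG.hasTemperateGrowth
  simp only [mul_comm (G _), mul_comm (fderiv ℝ G _ _)] at hGF
  have hsub : ((k : ℝ) - m) * ∫ y, F y * G y ∂gaussian n γ = 0 := by linarith
  exact (mul_eq_zero.mp hsub).resolve_left (sub_ne_zero.mpr (by exact_mod_cast hkm))

theorem integral_inner_pow_succ_mul (hγ : 0 < γ) (hG : IsSolidHarmonic (m + 1) G)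
    (x : EuclideanSpace ℝ (Fin n)) (j : ℕ) :
    (m + 1) * ∫ y, inner ℝ x y ^ (j + 1) * G y ∂gaussian n γ =
      γ / 2 * (j + 1) * ∫ y, inner ℝ x y ^ j * fderiv ℝ G y x ∂gaussian n γ := by
  let e := EuclideanSpace.basisFun (Fin n) ℝ
  have hgrad (y) : ∑ i, fderiv ℝ (fun z => inner ℝ x z ^ (j + 1)) y (e i) * fderiv ℝ G y (e i) =
      (j + 1) * (inner ℝ x y ^ j * fderiv ℝ G y x) := by
    conv_rhs => rw [← e.sum_repr' x, map_sum, e.sum_repr' x, Finset.mul_sum, Finset.mul_sum]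
    refine Finset.sum_congr rfl fun i _ => ?_
    rw [fderiv_pow_apply (F := fun z => inner ℝ x z) (innerSL ℝ x).contDiff,
      fderiv_inner_right_apply, real_inner_comm (e i) x, _root_.map_smul]
    simp only [Nat.cast_add_one, Nat.add_sub_cancel, smul_eq_mul]
    ring
  have h := hG.mul_integral_mul hγ e (hasTemperateGrowth_inner_right_pow x (j + 1))
  simp only [hgrad, integral_const_mul, Nat.cast_add_one] at h
  rw [h, mul_assoc]

theorem integral_inner_pow_mul_eq_zero (hγ : 0 < γ) (hG : IsSolidHarmonic m G) {j : ℕ} (hj : j < m)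
    (x : EuclideanSpace ℝ (Fin n)) : ∫ y, inner ℝ x y ^ j * G y ∂gaussian n γ = 0 := by
  obtain ⟨m, rfl⟩ := Nat.exists_eq_add_one_of_ne_zero (Nat.ne_zero_of_lt hj)
  suffices h : ((m : ℝ) + 1) * ∫ y, inner ℝ x y ^ j * G y ∂gaussian n γ = 0 from
    (mul_eq_zero.mp h).resolve_left (by positivity)
  induction j generalizing m G with
  | zero =>
    simpa using hG.mul_integral_mul hγ (EuclideanSpace.basisFun (Fin n) ℝ)
      (Function.HasTemperateGrowth.const 1)
  | succ j ih =>
    obtain ⟨m, rfl⟩ := Nat.exists_eq_add_one_of_ne_zero (n := m) (by omega)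
    have h := ih m (hG.fderiv_apply x) (by omega)
    rw [hG.integral_inner_pow_succ_mul hγ, (mul_eq_zero.mp h).resolve_left (by positivity),
      mul_zero]

theorem integral_inner_pow_mul (hγ : 0 < γ) (hG : IsSolidHarmonic m G)
    (x : EuclideanSpace ℝ (Fin n)) :
    ∫ y, inner ℝ x y ^ m * G y ∂gaussian n γ = m.factorial * (γ / 2) ^ m * G x := by
  induction m generalizing G with
  | zero =>
    have := isProbabilityMeasure_gaussian (n := n) hγ
    simp [hG.of_zero_eq]
  | succ m ih =>
    have h := hG.integral_inner_pow_succ_mul hγ x m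
    rw [ih (hG.fderiv_apply x), hG.euler] at h
    have hm : (m : ℝ) + 1 ≠ 0 := by positivity
    refine mul_left_cancel₀ hm (h.trans ?_)
    rw [Nat.factorial_succ]
    push_cast
    ring

theorem integral_fockZonal_mul (hγ : 0 < γ) (hG : IsSolidHarmonic m G)
    (x : EuclideanSpace ℝ (Fin n)) :
    ∫ y, fockZonal m x y * G y ∂gaussian n γ = γ ^ m * G x := by
  have hgrowth (l) : (fun y => inner ℝ x y ^ (m - 2 * l) * G y).HasTemperateGrowth :=
    (hasTemperateGrowth_inner_right_pow x _).mul hG.hasTemperateGrowth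
  have hgrowth' (l) :
      (fun y => inner ℝ x y ^ (m - 2 * l) * G y * (‖y‖ ^ 2) ^ l).HasTemperateGrowth :=
    (hgrowth l).mul (hasTemperateGrowth_norm_sq_pow l)
  have hterm (y) : fockZonal m x y * G y = ∑ l ∈ Finset.range (m / 2 + 1),
      fockZonalCoeff n m l * (‖x‖ ^ 2) ^ l *
        (inner ℝ x y ^ (m - 2 * l) * G y * (‖y‖ ^ 2) ^ l) := by
    rw [fockZonal, Finset.sum_mul, finrank_euclideanSpace_fin]
    exact Finset.sum_congr rfl fun l _ => by ring
  simp only [hterm]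
  rw [integral_finsetSum _ fun l _ =>
    (integrable_of_hasTemperateGrowth hγ (hgrowth' l)).const_mul _]
  simp only [integral_const_mul]
  rw [Finset.sum_eq_single_of_mem 0 (by simp)]
  · simp only [pow_zero, mul_one, mul_zero, Nat.sub_zero, hG.integral_inner_pow_mul hγ,
      fockZonalCoeff, div_pow]
    field_simp
  · intro l hl hl₀
    have hlm : m - 2 * l < m := by have := Finset.mem_range.mp hl; omega
    rw [integral_mul_norm_sq_pow_gaussian_eq_zero hγ (hgrowth l)
      (euler_mul ((hasTemperateGrowth_inner_right_pow x _).1.differentiable (by simp))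
        (hG.contDiff.differentiable (by simp)) (euler_inner_right_pow x _) hG.euler)
      (hG.integral_inner_pow_mul_eq_zero hγ hlm x), mul_zero]

end IsSolidHarmonic

end Gaussian

section Kernel

variable {n : ℕ} {α γ : ℝ}

theorem ascPochhammer_half_eval (n k : ℕ) :
    (ascPochhammer ℝ k).eval ((n : ℝ) / 2) =
      (∏ j ∈ Finset.range k, ((n : ℝ) + 2 * j)) / 2 ^ k := by
  induction k with
  | zero => simp
  | succ k ih =>
    rw [ascPochhammer_succ_eval, ih, Finset.prod_range_succ, pow_succ]
    field_simp

theorem ascPochhammer_half_pos (hn : 0 < n) (k : ℕ) :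
    0 < (ascPochhammer ℝ k).eval ((n : ℝ) / 2) :=
  ascPochhammer_pos k _ (by positivity)

/-- The coefficient of `⟨x, ξ⟩ ^ (k - 2 * l) * ‖x‖ ^ (2 * l)` in the zonal harmonic of degree
`k ≠ 0`, without the common factor `n + 2 * k - 2`. -/
def zonalCoeff (n k l : ℕ) : ℝ :=
  (-1) ^ l * (∏ j ∈ Finset.range (k - l - 1), ((n : ℝ) + 2 * j)) /
    (2 ^ l * (l.factorial : ℝ) * ((k - 2 * l).factorial : ℝ))

theorem zonalCoeff_succ_mul (n : ℕ) {k l : ℕ} (hl : 2 * (l + 1) ≤ k) :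
    4 * (l + 1) * (n / 2 + k - 2 - l) * zonalCoeff n k (l + 1) =
      -((k - 2 * l) * (k - 2 * l - 1)) * zonalCoeff n k l := by
  obtain ⟨d, rfl⟩ := Nat.exists_eq_add_of_le hl
  rw [zonalCoeff, zonalCoeff, show 2 * (l + 1) + d - l - 1 = l + d + 1 by omega,
    show 2 * (l + 1) + d - 2 * l = d + 2 by omega,
    show 2 * (l + 1) + d - (l + 1) - 1 = l + d by omega,
    show 2 * (l + 1) + d - 2 * (l + 1) = d by omega, Finset.prod_range_succ]
  simp only [Nat.factorial_succ, pow_succ]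
  push_cast
  field_simp
  ring

theorem mul_zonalCoeff_eq (hn : 0 < n) {k l : ℕ} (hk : k ≠ 0) (hl : 2 * l ≤ k) :
    ((n : ℝ) + 2 * k - 2) * zonalCoeff n k l =
      (ascPochhammer ℝ k).eval ((n : ℝ) / 2) * fockZonalCoeff n k l := by
  induction l with
  | zero =>
    obtain ⟨k, rfl⟩ := Nat.exists_eq_add_one_of_ne_zero hk
    rw [ascPochhammer_half_eval, fockZonalCoeff, zonalCoeff]
    simp only [Nat.sub_zero, Nat.add_sub_cancel, Finset.prod_range_succ, Nat.cast_add_one, mul_zero,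
      pow_zero, Nat.factorial_zero]
    field_simp
    ring
  | succ l ih =>
    have hpos : 0 < (4 : ℝ) * (l + 1) * (n / 2 + k - 2 - l) := by
      have hn' : (0 : ℝ) < n := by exact_mod_cast hn
      have hl' : (2 : ℝ) * (l + 1) ≤ k := by exact_mod_cast hl
      have : (0 : ℝ) < n / 2 + k - 2 - l := by linarith [(Nat.cast_nonneg l : (0 : ℝ) ≤ l)]
      positivity
    refine mul_left_cancel₀ hpos.ne' ?_
    rw [mul_left_comm, zonalCoeff_succ_mul n hl, mul_left_comm, ih (by omega), mul_left_comm,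
      ← fockZonalCoeff_succ_mul hn (by omega), mul_left_comm]

theorem zonalExt_eq_sum {k : ℕ} (hk : k ≠ 0) (x y : EuclideanSpace ℝ (Fin n)) :
    zonalExt k x y = ∑ l ∈ Finset.range (k / 2 + 1), ((n : ℝ) + 2 * k - 2) * zonalCoeff n k l *
      ((‖x‖ ^ 2) ^ l * (inner ℝ x y ^ (k - 2 * l) * (‖y‖ ^ 2) ^ l)) := by
  rw [zonalExt, zonal, if_neg hk, Finset.mul_sum, Finset.mul_sum]
  refine Finset.sum_congr rfl fun l hl => ?_
  have hkl : k = k - 2 * l + 2 * l := by have := Finset.mem_range.mp hl; omega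
  rw [← zonalCoeff, inner_smul_right, mul_pow, ← pow_mul, ← pow_mul]
  rcases eq_or_ne y 0 with rfl | hy
  · rcases Nat.eq_zero_or_pos l with rfl | hl₀
    · simp [hk]
    · simp [hk, hl₀.ne']
  · have hnorm : ‖y‖ ^ k * ‖y‖⁻¹ ^ (k - 2 * l) = ‖y‖ ^ (2 * l) := by
      have hy' : ‖y‖ ≠ 0 := norm_ne_zero_iff.mpr hy
      nth_rw 1 [hkl, pow_add, mul_right_comm, ← mul_pow, mul_inv_cancel₀ hy', one_pow, one_mul]
    rw [← hnorm]
    ring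

theorem zonalExt_eq_mul_fockZonal (hn : 0 < n) (k : ℕ) (x y : EuclideanSpace ℝ (Fin n)) :
    zonalExt k x y = (ascPochhammer ℝ k).eval ((n : ℝ) / 2) * fockZonal k x y := by
  rcases eq_or_ne k 0 with rfl | hk
  · simp [zonalExt, zonal, fockZonal, fockZonalCoeff]
  · rw [zonalExt_eq_sum hk, fockZonal, finrank_euclideanSpace_fin, Finset.mul_sum]
    refine Finset.sum_congr rfl fun l hl => ?_
    have hl' : 2 * l ≤ k := by have := Finset.mem_range.mp hl; omega
    rw [mul_zonalCoeff_eq hn hk hl']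
    ring

theorem kernel_eq_tsum (hn : 0 < n) (x y : EuclideanSpace ℝ (Fin n)) :
    kernel α x y = ∑' k, fockZonal k x y / α ^ k := by
  refine tsum_congr fun k => ?_
  rw [zonalExt_eq_mul_fockZonal hn, mul_comm,
    mul_div_mul_right _ _ (ascPochhammer_half_pos hn k).ne']

theorem mul_choose_two_mul {k l : ℕ} (hl : 2 * (l + 1) ≤ k) :
    ((k : ℝ) - 2 * l) * (k - 2 * l - 1) * k.choose (2 * l) =
      (2 * l + 1) * (2 * l + 2) * k.choose (2 * (l + 1)) := by
  have h₁ := congrArg (Nat.cast (R := ℝ)) (k.choose_succ_right_eq (2 * l))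
  have h₂ := congrArg (Nat.cast (R := ℝ)) (k.choose_succ_right_eq (2 * l + 1))
  push_cast [Nat.cast_sub (show 2 * l ≤ k by omega),
    Nat.cast_sub (show 2 * l + 1 ≤ k by omega)] at h₁ h₂
  rw [show 2 * (l + 1) = 2 * l + 1 + 1 by ring]
  linear_combination (2 * l + 1 - k) * h₁ - (2 * l + 1) * h₂

theorem sum_choose_two_mul_le (k : ℕ) :
    ∑ l ∈ Finset.range (k / 2 + 1), k.choose (2 * l) ≤ 2 ^ k := by
  have hsub : (Finset.range (k / 2 + 1)).image (2 * ·) ⊆ Finset.range (k + 1) := by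
    intro i
    simp only [Finset.mem_image, Finset.mem_range]
    omega
  have h := Finset.sum_le_sum_of_subset (f := k.choose) hsub
  rwa [Finset.sum_image fun _ _ _ _ h => by simpa using h, Nat.sum_range_choose] at h

theorem abs_fockZonalCoeff_le (hn : 0 < n) {k l : ℕ} (hl : 2 * l ≤ k) :
    |fockZonalCoeff n k l| ≤ 2 ^ k / k.factorial * k.choose (2 * l) := by
  induction l with
  | zero =>
    rw [fockZonalCoeff, abs_of_nonneg (by positivity), mul_zero, Nat.choose_zero_right,
      Nat.cast_one, mul_one]
  | succ l ih =>
    have hl' : (2 : ℝ) * l + 2 ≤ k := by exact_mod_cast hl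
    have hn' : (1 : ℝ) ≤ n := by exact_mod_cast hn
    have hnum : (0 : ℝ) ≤ (k - 2 * l) * (k - 2 * l - 1) :=
      mul_nonneg (by linarith) (by linarith)
    have hden : (0 : ℝ) < 4 * (l + 1) * (n / 2 + k - 2 - l) :=
      mul_pos (by positivity) (by linarith)
    refine le_of_mul_le_mul_left ?_ hden
    calc 4 * (l + 1) * (n / 2 + k - 2 - l) * |fockZonalCoeff n k (l + 1)|
        = (k - 2 * l) * (k - 2 * l - 1) * |fockZonalCoeff n k l| := by
          rw [← abs_of_pos hden, ← abs_mul, fockZonalCoeff_succ_mul hn (by omega), abs_mul,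
            abs_neg, abs_of_nonneg hnum]
      _ ≤ (k - 2 * l) * (k - 2 * l - 1) * (2 ^ k / k.factorial * k.choose (2 * l)) := by
          gcongr
          exact ih (by omega)
      _ = (2 * l + 2) * (2 * l + 1) * (2 ^ k / k.factorial * k.choose (2 * (l + 1))) := by
          linear_combination 2 ^ k / k.factorial * mul_choose_two_mul hl
      _ ≤ 4 * (l + 1) * (n / 2 + k - 2 - l) *
            (2 ^ k / k.factorial * k.choose (2 * (l + 1))) := by
          gcongr ?_ * _
          nlinarith

theorem abs_fockZonal_le (hn : 0 < n) (k : ℕ) (x y : EuclideanSpace ℝ (Fin n)) :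
    |fockZonal k x y| ≤ (4 * ‖x‖ * ‖y‖) ^ k / k.factorial := by
  rw [fockZonal, finrank_euclideanSpace_fin]
  calc _ ≤ ∑ l ∈ Finset.range (k / 2 + 1),
        2 ^ k / k.factorial * (‖x‖ * ‖y‖) ^ k * k.choose (2 * l) := by
        refine (Finset.abs_sum_le_sum_abs _ _).trans (Finset.sum_le_sum fun l hl => ?_)
        have hl' : 2 * l ≤ k := by have := Finset.mem_range.mp hl; omega
        have hpow : (‖x‖ * ‖y‖) ^ k =
            (‖x‖ ^ 2) ^ l * ((‖x‖ * ‖y‖) ^ (k - 2 * l) * (‖y‖ ^ 2) ^ l) := by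
          nth_rw 1 [← Nat.sub_add_cancel hl', pow_add, mul_pow _ _ (2 * l), pow_mul, pow_mul]
          ring
        have hx : 0 ≤ (‖x‖ ^ 2) ^ l := by positivity
        have hy : 0 ≤ (‖y‖ ^ 2) ^ l := by positivity
        rw [hpow, abs_mul, abs_mul, abs_mul, abs_pow (inner ℝ x y), abs_of_nonneg hx,
          abs_of_nonneg hy, mul_right_comm (2 ^ k / _), mul_assoc]
        gcongr
        · exact abs_fockZonalCoeff_le hn hl'
        · exact abs_real_inner_le_norm x y
    _ ≤ 2 ^ k / k.factorial * (‖x‖ * ‖y‖) ^ k * 2 ^ k := by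
        rw [← Finset.mul_sum]
        gcongr
        exact_mod_cast sum_choose_two_mul_le k
    _ = _ := by
        rw [mul_assoc 4, mul_pow 4, show (4 : ℝ) = 2 * 2 by norm_num, mul_pow 2 2]
        ring

theorem abs_fockZonal_div_le (hn : 0 < n) (hα : 0 < α) (k : ℕ) (x y : EuclideanSpace ℝ (Fin n)) :
    |fockZonal k x y / α ^ k| ≤ (4 * ‖x‖ / α * ‖y‖) ^ k / k.factorial := by
  rw [abs_div, abs_of_pos (pow_pos hα k), div_le_iff₀ (pow_pos hα k)]
  refine (abs_fockZonal_le hn k x y).trans_eq ?_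
  simp only [mul_pow, div_pow]
  field_simp

theorem hasSum_kernel (hn : 0 < n) (hα : 0 < α) (x y : EuclideanSpace ℝ (Fin n)) :
    HasSum (fun k => fockZonal k x y / α ^ k) (kernel α x y) := by
  rw [kernel_eq_tsum hn]
  exact (Summable.of_norm_bounded (Real.summable_pow_div_factorial _)
    (fun k => abs_fockZonal_div_le hn hα k x y)).hasSum

theorem hasSum_exp_mul (B r : ℝ) :
    HasSum (fun k : ℕ => (B * r) ^ k / k.factorial) (Real.exp (B * r)) := by
  rw [Real.exp_eq_exp_ℝ]
  exact NormedSpace.expSeries_div_hasSum_exp _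

theorem abs_kernel_le (hn : 0 < n) (hα : 0 < α) (x y : EuclideanSpace ℝ (Fin n)) :
    |kernel α x y| ≤ Real.exp (4 * ‖x‖ / α * ‖y‖) :=
  (hasSum_kernel hn hα x y).norm_le_of_bounded (hasSum_exp_mul _ _)
    fun k => abs_fockZonal_div_le hn hα k x y

theorem continuous_fockZonal (k : ℕ) (x : EuclideanSpace ℝ (Fin n)) :
    Continuous (fockZonal k x) := by
  unfold fockZonal
  fun_prop

theorem measurable_kernel (hn : 0 < n) (hα : 0 < α) (x : EuclideanSpace ℝ (Fin n)) :
    Measurable (kernel α x) := by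
  refine measurable_of_tendsto_metrizable
    (f := fun N y => ∑ k ∈ Finset.range N, fockZonal k x y / α ^ k) (fun N => ?_)
    (tendsto_pi_nhds.mpr fun y => (hasSum_kernel hn hα x y).tendsto_sum_nat)
  exact (continuous_finsetSum _ fun k _ => (continuous_fockZonal k x).div_const _).measurable

theorem integrable_kernel_mul (hn : 0 < n) (hα : 0 < α) (hγ : 0 < γ)
    {F : EuclideanSpace ℝ (Fin n) → ℝ} (hF : F.HasTemperateGrowth)
    (x : EuclideanSpace ℝ (Fin n)) :
    Integrable (fun y => kernel α x y * F y) (gaussian n γ) := by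
  refine (integrable_exp_mul_norm_mul hγ (4 * ‖x‖ / α) hF).mono
    ((measurable_kernel hn hα x).mul hF.1.continuous.measurable).aestronglyMeasurable
    (.of_forall fun y => ?_)
  rw [norm_mul, norm_mul, Real.norm_of_nonneg (Real.exp_pos _).le]
  gcongr
  exact abs_kernel_le hn hα x y

theorem IsSolidHarmonic.integral_kernel_mul (hn : 0 < n) (hα : 0 < α) (hγ : 0 < γ) {m : ℕ}
    {G : EuclideanSpace ℝ (Fin n) → ℝ} (hG : IsSolidHarmonic m G)
    (x : EuclideanSpace ℝ (Fin n)) :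
    ∫ y, kernel α x y * G y ∂gaussian n γ = (γ / α) ^ m * G x := by
  have : Nontrivial (EuclideanSpace ℝ (Fin n)) :=
    Module.nontrivial_of_finrank_pos (R := ℝ) (by simpa using hn)
  have hG' : Continuous G := hG.contDiff.continuous
  have hsum : HasSum (fun k => ∫ y, fockZonal k x y / α ^ k * G y ∂gaussian n γ)
      (∫ y, kernel α x y * G y ∂gaussian n γ) := by
    refine hasSum_integral_of_dominated_convergence
      (fun k y => (4 * ‖x‖ / α * ‖y‖) ^ k / k.factorial * ‖G y‖)
      (fun k => (((continuous_fockZonal k x).div_const _).mul hG').aestronglyMeasurable)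
      (fun k => .of_forall fun y => ?_)
      (.of_forall fun y => (Real.summable_pow_div_factorial _).mul_right _) ?_
      (.of_forall fun y => (hasSum_kernel hn hα x y).mul_right _)
    · rw [norm_mul]
      gcongr
      exact abs_fockZonal_div_le hn hα k x y
    · refine (integrable_exp_mul_norm_mul hγ (4 * ‖x‖ / α) hG.hasTemperateGrowth).norm.congr
        (.of_forall fun y => ?_)
      simp only [tsum_mul_right, (hasSum_exp_mul _ _).tsum_eq, norm_mul,
        Real.norm_of_nonneg (Real.exp_pos _).le]
  have hterm (k) : ∫ y, fockZonal k x y / α ^ k * G y ∂gaussian n γ =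
      (∫ y, fockZonal k x y * G y ∂gaussian n γ) / α ^ k := by
    simp only [div_mul_eq_mul_div, integral_div]
  simp only [hterm] at hsum
  rw [hsum.unique (hasSum_single m fun k hk => by
    rw [(isSolidHarmonic_fockZonal k x).integral_mul_eq_zero hγ hG hk, zero_div]),
    hG.integral_fockZonal_mul hγ, div_pow]
  ring

end Kernel

section Boundedness

variable {n m : ℕ} {α β γ p s : ℝ} {F G : EuclideanSpace ℝ (Fin n) → ℝ}

theorem inv_div_one_add_mul (hγ : 0 < γ) (s : ℝ) : (γ / (1 + s * γ))⁻¹ = γ⁻¹ + s := by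
  field_simp

theorem integrable_exp_mul_gaussian_iff (hγ : 0 < γ) (hs : 0 < 1 + s * γ) :
    Integrable (fun y => Real.exp (-s * ‖y‖ ^ 2) * F y) (gaussian n γ) ↔
      Integrable F (gaussian n (γ / (1 + s * γ))) := by
  rw [integrable_gaussian_iff hγ, integrable_gaussian_iff (div_pos hγ hs),
    inv_div_one_add_mul hγ]
  simp only [← mul_assoc, ← Real.exp_add, ← add_mul, neg_add]

theorem integral_exp_mul_gaussian (hγ : 0 < γ) (hs : 0 < 1 + s * γ)
    (F : EuclideanSpace ℝ (Fin n) → ℝ) :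
    ∫ y, Real.exp (-s * ‖y‖ ^ 2) * F y ∂gaussian n γ =
      (1 + s * γ) ^ (-(n : ℝ) / 2) * ∫ y, F y ∂gaussian n (γ / (1 + s * γ)) := by
  rw [integral_gaussian hγ, integral_gaussian (div_pos hγ hs), inv_div_one_add_mul hγ, ← mul_assoc,
    ← Real.mul_rpow hs.le (by positivity), mul_left_comm, mul_div_cancel₀ _ hs.ne']
  simp only [← mul_assoc, ← Real.exp_add, ← add_mul, neg_add]

theorem integral_comp_smul_gaussian (hγ : 0 < γ) {r : ℝ} (hr : 0 < r)
    (F : EuclideanSpace ℝ (Fin n) → ℝ) :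
    ∫ y, F (r • y) ∂gaussian n γ = ∫ y, F y ∂gaussian n (r ^ 2 * γ) := by
  have hexp (y : EuclideanSpace ℝ (Fin n)) :
      Real.exp (-γ⁻¹ * ‖y‖ ^ 2) = Real.exp (-(r ^ 2 * γ)⁻¹ * ‖r • y‖ ^ 2) := by
    rw [norm_smul, Real.norm_of_nonneg hr.le]
    congr 1
    field_simp
  have hconst : (Real.pi * (r ^ 2 * γ)) ^ (-(n : ℝ) / 2) =
      (Real.pi * γ) ^ (-(n : ℝ) / 2) * (r ^ n)⁻¹ := by
    rw [mul_left_comm, mul_comm, Real.mul_rpow (by positivity) (by positivity),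
      ← Real.rpow_natCast r 2, ← Real.rpow_mul hr.le, ← Real.rpow_natCast r n,
      ← Real.rpow_neg hr.le]
    congr 2
    push_cast
    ring
  rw [integral_gaussian hγ, integral_gaussian (by positivity)]
  simp only [hexp]
  rw [Measure.integral_comp_smul_of_nonneg volume
    (fun y => Real.exp (-(r ^ 2 * γ)⁻¹ * ‖y‖ ^ 2) * F y) r
    (hR := hr.le), finrank_euclideanSpace_fin,
    smul_eq_mul, hconst, mul_assoc]

theorem memLp_of_hasTemperateGrowth (hγ : 0 < γ) (hF : F.HasTemperateGrowth) {q : ℝ≥0∞}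
    (hq : q ≠ ⊤) : MemLp F q (gaussian n γ) := by
  have := isProbabilityMeasure_gaussian (n := n) hγ
  obtain ⟨k, hk⟩ := ENNReal.exists_nat_gt hq
  have hcont := hF.1.continuous
  have hmem : MemLp F (k : ℝ≥0∞) (gaussian n γ) := by
    rw [← integrable_norm_rpow_iff hcont.aestronglyMeasurable (pos_of_gt hk).ne'
      (ENNReal.natCast_ne_top k)]
    simpa using (integrable_of_hasTemperateGrowth hγ (hF.pow k)).norm
  exact hmem.mono_exponent hk.le

theorem volume_absolutelyContinuous_gaussian (hγ : 0 < γ) : volume ≪ gaussian n γ :=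
  withDensity_absolutelyContinuous' (measurable_gaussian_density γ).aemeasurable
    (.of_forall fun y => by simpa using by positivity)

theorem eLpNorm_gaussian_ne_zero (hγ : 0 < γ) {q : ℝ≥0∞} (hq : q ≠ 0) (hF : Continuous F)
    (hF₀ : F ≠ 0) : eLpNorm F q (gaussian n γ) ≠ 0 := by
  have := (volume_absolutelyContinuous_gaussian (n := n) hγ).isOpenPosMeasure
  rw [Ne, eLpNorm_eq_zero_iff hF.aestronglyMeasurable hq]
  exact fun h => hF₀ (hF.ae_eq_iff_eq _ continuous_zero |>.mp h)

theorem IsSolidHarmonic.integral_norm_rpow_gaussian (hG : IsSolidHarmonic m G) (hγ : 0 < γ) {c : ℝ}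
    (hc : 0 < c) (p : ℝ) :
    ∫ y, ‖G y‖ ^ p ∂gaussian n (γ / c) =
      c ^ (-(m * p / 2)) * ∫ y, ‖G y‖ ^ p ∂gaussian n γ := by
  have hr : 0 < c ^ (-(1 / 2) : ℝ) := by positivity
  have hscale : γ / c = (c ^ (-(1 / 2) : ℝ)) ^ 2 * γ := by
    rw [← Real.rpow_mul_natCast hc.le, div_eq_inv_mul, ← Real.rpow_neg_one]
    norm_num
  have hpow : ((c ^ (-(1 / 2) : ℝ)) ^ m) ^ p = c ^ (-(m * p / 2)) := by
    rw [← Real.rpow_mul_natCast hc.le, ← Real.rpow_mul hc.le]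
    congr 1
    ring
  rw [hscale, ← integral_comp_smul_gaussian hγ hr, ← integral_const_mul]
  simp only [hG.map_smul, norm_mul, Real.norm_of_nonneg (pow_pos hr m).le,
    Real.mul_rpow (pow_pos hr m).le (norm_nonneg _), hpow]

theorem norm_exp_mul_rpow (p s : ℝ) (F : EuclideanSpace ℝ (Fin n) → ℝ)
    (y : EuclideanSpace ℝ (Fin n)) :
    ‖Real.exp (-s * ‖y‖ ^ 2) * F y‖ ^ p = Real.exp (-(p * s) * ‖y‖ ^ 2) * ‖F y‖ ^ p := by
  rw [norm_mul, Real.norm_of_nonneg (Real.exp_pos _).le,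
    Real.mul_rpow (Real.exp_pos _).le (norm_nonneg _), ← Real.exp_mul]
  congr 2
  ring

theorem memLp_exp_mul_gaussian (hβ : 0 < β) (hp : 0 < p) (hs : 0 < 1 + p * s * β)
    (hF : F.HasTemperateGrowth) :
    MemLp (fun y => Real.exp (-s * ‖y‖ ^ 2) * F y) (ENNReal.ofReal p) (gaussian n β) := by
  have hcont := hF.1.continuous
  have hp' : ENNReal.ofReal p ≠ 0 := by simpa using hp
  rw [← integrable_norm_rpow_iff (Continuous.aestronglyMeasurable (by fun_prop)) hp'
    ENNReal.ofReal_ne_top, ENNReal.toReal_ofReal hp.le]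
  simp only [norm_exp_mul_rpow]
  rw [integrable_exp_mul_gaussian_iff hβ hs]
  simpa only [ENNReal.toReal_ofReal hp.le] using
    (memLp_of_hasTemperateGrowth (div_pos hβ hs) hF ENNReal.ofReal_ne_top).integrable_norm_rpow hp'
      ENNReal.ofReal_ne_top

theorem IsSolidHarmonic.eLpNorm_exp_mul_gaussian (hG : IsSolidHarmonic m G) (hβ : 0 < β)
    (hp : 0 < p) (hs : 0 < 1 + p * s * β) :
    eLpNorm (fun y => Real.exp (-s * ‖y‖ ^ 2) * G y) (ENNReal.ofReal p) (gaussian n β) =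
      ENNReal.ofReal ((1 + p * s * β) ^ (-((m : ℝ) / 2 + n / (2 * p)))) *
        eLpNorm G (ENNReal.ofReal p) (gaussian n β) := by
  have hp' : ENNReal.ofReal p ≠ 0 := by simpa using hp
  have hpow : ((1 + p * s * β) ^ (-(n : ℝ) / 2) * (1 + p * s * β) ^ (-(m * p / 2))) ^ p⁻¹ =
      (1 + p * s * β) ^ (-((m : ℝ) / 2 + n / (2 * p))) := by
    rw [← Real.rpow_add hs, ← Real.rpow_mul hs.le]
    congr 1
    field_simp
    ring
  rw [(memLp_exp_mul_gaussian hβ hp hs hG.hasTemperateGrowth).eLpNorm_eq_integral_rpow_norm hp'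
      ENNReal.ofReal_ne_top,
    (memLp_of_hasTemperateGrowth hβ hG.hasTemperateGrowth
      ENNReal.ofReal_ne_top).eLpNorm_eq_integral_rpow_norm hp' ENNReal.ofReal_ne_top,
    ENNReal.toReal_ofReal hp.le, ← ENNReal.ofReal_mul (by positivity)]
  simp only [norm_exp_mul_rpow]
  rw [integral_exp_mul_gaussian hβ hs, hG.integral_norm_rpow_gaussian hβ hs, ← mul_assoc,
    Real.mul_rpow (by positivity) (by positivity), hpow]

theorem inDomain_exp_mul (hn : 0 < n) (hα : 0 < α) (hs : 0 < 1 + s * α)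
    (hF : F.HasTemperateGrowth) : InDomain α fun y => Real.exp (-s * ‖y‖ ^ 2) * F y := by
  refine .of_forall fun x => ?_
  simp only [smul_eq_mul, mul_left_comm (kernel α x _)]
  rw [integrable_exp_mul_gaussian_iff hα hs]
  exact integrable_kernel_mul hn hα (div_pos hα hs) hF x

theorem IsSolidHarmonic.proj_exp_mul (hG : IsSolidHarmonic m G) (hn : 0 < n) (hα : 0 < α)
    (hs : 0 < 1 + s * α) :
    proj α (fun y => Real.exp (-s * ‖y‖ ^ 2) * G y) =
      (1 + s * α) ^ (-((m : ℝ) + n / 2)) • G := by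
  funext x
  simp only [proj, smul_eq_mul, mul_left_comm (kernel α x _)]
  rw [integral_exp_mul_gaussian hα hs, hG.integral_kernel_mul hn hα (div_pos hα hs),
    div_div_cancel_left' hα.ne', inv_pow, ← Real.rpow_natCast, ← Real.rpow_neg hs.le, ← mul_assoc,
    ← Real.rpow_add hs, Pi.smul_apply, smul_eq_mul]
  ring_nf

theorem BoundedOn.exists_rpow_le (hn : 2 ≤ n) (hα : 0 < α) (hβ : 0 < β) (hp : 0 < p)
    (h : BoundedOn ℝ n α β p) :
    ∃ C : ℝ, ∀ (m : ℕ) (s : ℝ), 0 < 1 + s * α → 0 < 1 + p * s * β →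
      (1 + p * s * β) ^ ((m : ℝ) / 2 + n / (2 * p)) ≤ C * (1 + s * α) ^ ((m : ℝ) + n / 2) := by
  obtain ⟨C, hC⟩ := h
  refine ⟨C, fun m s hs hs' => ?_⟩
  obtain ⟨G, y, hG, hGy⟩ : ∃ (G : EuclideanSpace ℝ (Fin n) → ℝ) (y : _),
      IsSolidHarmonic m G ∧ G y ≠ 0 := exists_isSolidHarmonic_ne_zero (by simpa using hn) m
  have hbound := (hC _ (memLp_exp_mul_gaussian hβ hp hs' hG.hasTemperateGrowth)
    (inDomain_exp_mul (by lia) hα hs hG.hasTemperateGrowth)).2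
  have hnorm₀ : eLpNorm G (ENNReal.ofReal p) (gaussian n β) ≠ 0 :=
    eLpNorm_gaussian_ne_zero hβ (by simpa using hp) hG.contDiff.continuous
      fun h => hGy (congrFun h y)
  have hnorm_top : eLpNorm G (ENNReal.ofReal p) (gaussian n β) ≠ ⊤ :=
    (memLp_of_hasTemperateGrowth hβ hG.hasTemperateGrowth ENNReal.ofReal_ne_top).eLpNorm_ne_top
  rw [hG.proj_exp_mul (by lia) hα hs, eLpNorm_const_smul, hG.eLpNorm_exp_mul_gaussian hβ hp hs',
    ← mul_assoc, ENNReal.mul_le_mul_iff_left hnorm₀ hnorm_top, ← ofReal_norm,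
    Real.norm_of_nonneg (by positivity), ← ENNReal.ofReal_coe_nnreal,
    ← ENNReal.ofReal_mul C.coe_nonneg, ENNReal.ofReal_le_ofReal_iff (by positivity),
    Real.rpow_neg hs.le, Real.rpow_neg hs'.le] at hbound
  rwa [← div_eq_mul_inv, le_div_iff₀ (by positivity), inv_mul_le_iff₀ (by positivity),
    mul_comm _ (C : ℝ)] at hbound

theorem le_sq_of_forall_rpow_le {A D a b C : ℝ} (hA : 0 < A) (hD : 0 < D)
    (h : ∀ k : ℕ, D ^ ((k : ℝ) / 2 + b) ≤ C * A ^ ((k : ℝ) + a)) : D ≤ A ^ 2 := by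
  by_contra! hlt
  have hq : 1 < √D / A := (one_lt_div hA).mpr (Real.lt_sqrt_of_sq_lt hlt)
  obtain ⟨k, hk⟩ := pow_unbounded_of_one_lt (C * A ^ a / D ^ b) hq
  refine hk.not_ge ?_
  have hsqrt : D ^ ((k : ℝ) / 2) = √D ^ k := by
    rw [Real.sqrt_eq_rpow, ← Real.rpow_mul_natCast hD.le, one_div_mul_eq_div]
  have hle := h k
  rw [Real.rpow_add hD, Real.rpow_add hA, Real.rpow_natCast, hsqrt] at hle
  rw [div_pow, div_le_div_iff₀ (by positivity) (by positivity)]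
  linarith

theorem exponent_le_of_forall_rpow_le {a b C : ℝ} (h : ∀ u : ℝ, 1 ≤ u → u ^ a ≤ C * u ^ b) :
    a ≤ b := by
  by_contra! hlt
  obtain ⟨u, hCu, hu⟩ := (((tendsto_rpow_atTop (sub_pos.mpr hlt)).eventually_gt_atTop C).and
    (Filter.eventually_ge_atTop 1)).exists
  have hu₀ : 0 < u := by linarith
  rw [Real.rpow_sub hu₀, lt_div_iff₀ (by positivity)] at hCu
  exact (h u hu).not_gt hCu

theorem BoundedOn.mul_eq (hn : 2 ≤ n) (hα : 0 < α) (hβ : 0 < β) (hp : 0 < p)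
    (h : BoundedOn ℝ n α β p) : p * β = 2 * α := by
  obtain ⟨C, hC⟩ := h.exists_rpow_le hn hα hβ hp
  -- `s ↦ (1 + sα)² - (1 + psβ)` is nonnegative near its zero `s = 0`, so its derivative vanishes.
  have hmin : IsLocalMin (fun s : ℝ => (1 + s * α) ^ 2 - (1 + p * s * β)) 0 := by
    have hα' : ∀ᶠ s : ℝ in nhds 0, 0 < 1 + s * α :=
      ContinuousAt.eventually_lt (by fun_prop) (by fun_prop) (by simp)
    have hβ' : ∀ᶠ s : ℝ in nhds 0, 0 < 1 + p * s * β :=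
      ContinuousAt.eventually_lt (by fun_prop) (by fun_prop) (by simp)
    filter_upwards [hα', hβ'] with s hs hs'
    have hle : 1 + p * s * β ≤ (1 + s * α) ^ 2 :=
      le_sq_of_forall_rpow_le hs hs' fun k => hC k s hs hs'
    simpa using hle
  have hderiv : HasDerivAt (fun s : ℝ => (1 + s * α) ^ 2 - (1 + p * s * β)) (2 * α - p * β) 0 := by
    have hα' : HasDerivAt (fun s : ℝ => 1 + s * α) α 0 := by
      simpa using ((hasDerivAt_id (0 : ℝ)).mul_const α).const_add 1
    have hβ' : HasDerivAt (fun s : ℝ => 1 + p * s * β) (p * β) 0 := by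
      simpa using (((hasDerivAt_id (0 : ℝ)).const_mul p).mul_const β).const_add 1
    simpa using (hα'.fun_pow 2).fun_sub hβ'
  linarith [hmin.hasDerivAt_eq_zero hderiv]

theorem BoundedOn.one_le (hn : 2 ≤ n) (hα : 0 < α) (hβ : 0 < β) (hp : 0 < p)
    (h : BoundedOn ℝ n α β p) : 1 ≤ p := by
  have hmul : p * β = 2 * α := h.mul_eq hn hα hβ hp
  obtain ⟨C, hC⟩ := h.exists_rpow_le hn hα hβ hp
  have hexp : (n : ℝ) / (2 * p) ≤ n / 2 := by
    refine exponent_le_of_forall_rpow_le (C := C) fun u hu => ?_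
    have hs : 1 + (u - 1) / α * α = u := by
      field_simp
      ring
    have hs' : 1 + p * ((u - 1) / α) * β = 2 * u - 1 := by
      rw [mul_right_comm, hmul]
      field_simp
      ring
    have hle := hC 0 ((u - 1) / α) (by linarith) (by linarith)
    rw [hs, hs', Nat.cast_zero, zero_div, zero_add, zero_add] at hle
    exact (Real.rpow_le_rpow (by linarith) (by linarith) (by positivity)).trans hle
  have hn₀ : (0 : ℝ) < n := by positivity
  rw [div_le_div_iff_of_pos_left hn₀ (by positivity) two_pos] at hexp
  linarith

theorem BoundedOn.real {𝕜 : Type*} [RCLike 𝕜] (h : BoundedOn 𝕜 n α β p) : BoundedOn ℝ n α β p := by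
  obtain ⟨C, hC⟩ := h
  refine ⟨C, fun f hf hdom => ?_⟩
  have hproj : proj α (fun y => (f y : 𝕜)) = fun x => ((proj α f x : ℝ) : 𝕜) := by
    funext x
    simp only [proj, ← integral_ofReal, smul_eq_mul, RCLike.real_smul_eq_coe_mul,
      RCLike.ofReal_mul]
  have hnorm (g : EuclideanSpace ℝ (Fin n) → ℝ) :
      eLpNorm (fun y => (g y : 𝕜)) (ENNReal.ofReal p) (gaussian n β) =
        eLpNorm g (ENNReal.ofReal p) (gaussian n β) :=
    eLpNorm_congr_norm_ae (.of_forall fun y => by simp only [RCLike.norm_ofReal, Real.norm_eq_abs])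
  have hdom' : InDomain α fun y => (f y : 𝕜) := by
    filter_upwards [hdom] with x hx
    simpa only [smul_eq_mul, RCLike.real_smul_eq_coe_mul, RCLike.ofReal_mul] using
      hx.ofReal (𝕜 := 𝕜)
  obtain ⟨hmem, hle⟩ := hC _ hf.ofReal hdom'
  rw [hproj] at hmem hle
  exact ⟨by simpa only [RCLike.ofReal_re] using hmem.re, by simpa only [hnorm] using hle⟩

end Boundedness

end HarmonicFock

end

theorem lemma2p2 (𝕜 : Type*) [RCLike 𝕜] (n : ℕ) (hn : 2 ≤ n) (α β p : ℝ)
    (hα : 0 < α) (hβ : 0 < β) :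
    (1 ≤ p → HarmonicFock.BoundedOn 𝕜 n α β p → p * β = 2 * α) ∧
      (0 < p → p < 1 → ¬ HarmonicFock.BoundedOn 𝕜 n α β p) :=
  ⟨fun hp h => h.real.mul_eq hn hα hβ (by linarith),
    fun hp hp1 h => (h.real.one_le hn hα hβ hp).not_gt hp1⟩
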